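/- Let $E$ be a (real) Banach lattice with norm dual $E'$, which carries its usual Banach lattice structure ($f\le g$ iff $f(x)\le g(x)$ for all $x\ge 0$). A net $(x_\alpha)$ in $E$ is called *un-null* (resp. *uaw-null*) if, for every $u\in E_+$, $|x_\alpha|\wedge u\to 0$ in norm (resp. in the weak topology $\sigma(E,E')$). A net or sequence is called *disjoint* if $|x_\alpha|\wedge|x_\beta|=0$ whenever $\alpha\neq\beta$; the index sets of disjoint nets are assumed to be directed sets without a greatest element. A functional $f\in E'$ is *bounded uaw-continuous* (resp. *bounded un-continuous*, *bounded d-continuous*) if $f(x_\alpha)\to 0$ for every norm bounded uaw-null (resp. un-null, disjoint) net $(x_\alpha)$ in $E$; the set of all such functionals is denoted by $E^\sim_{uaw}$ (resp. $E^\sim_{un}$, $E^\sim_{d}$). For every $f\in E'$ the following conditions are equivalent. 1. $f\in E^\sim_{uaw}$. 2. $f(x_n)\to 0$ for every norm bounded uaw-null sequence $(x_n)$ in $E$. 3. $f\in E^\sim_{d}$. 4. $f(x_n)\to 0$ for every norm bounded disjoint sequence $(x_n)$ in $E$. 5. Every disjoint sequence in $[0,|f|]\subset E'$ converges to zero in norm.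 If, in addition, $E$ has order continuous norm (that is, $\|x_\alpha\|\to 0$ for every net $x_\alpha\downarrow 0$ in $E$), then conditions 1–5 are also equivalent to each of the following. 6. $f\in E^\sim_{un}$. 7. $f(x_n)\to 0$ for every norm bounded un-null sequence $(x_n)$ in $E$. -/

import Mathlib

open Filter Topology

universe u v

namespace BanachLatticeDual

section

variable {E : Type u} [NormedAddCommGroup E] [NormedSpace ℝ E] [Lattice E]
  [IsOrderedAddMonoid E] [HasSolidNorm E]

theorem norm_le_of_mem_Icc {x y : E} (hy : y ∈ Set.Icc 0 x) : ‖y‖ ≤ ‖x‖ :=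
  HasSolidNorm.solid (by
    rw [abs_of_nonneg hy.1, abs_of_nonneg (hy.1.trans hy.2)]; exact hy.2)

theorem bddAbove_image (h : StrongDual ℝ E) (x : E) : BddAbove (h '' Set.Icc 0 x) := by
  refine ⟨‖h‖ * ‖x‖, ?_⟩
  rintro _ ⟨y, hy, rfl⟩
  calc h y ≤ ‖h y‖ := Real.le_norm_self _
    _ ≤ ‖h‖ * ‖y‖ := h.le_opNorm y
    _ ≤ ‖h‖ * ‖x‖ := by gcongr; exact norm_le_of_mem_Icc hy

/-- The values of the positive part of `h` on the positive cone:
`h⁺(x) = sup {h y : 0 ≤ y ≤ x}` for `x ≥ 0`. -/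
noncomputable def conePos (h : StrongDual ℝ E) (x : E) : ℝ := sSup (h '' Set.Icc 0 x)

theorem le_conePos (h : StrongDual ℝ E) {x y : E} (hy : y ∈ Set.Icc 0 x) :
    h y ≤ conePos h x :=
  le_csSup (bddAbove_image h x) ⟨y, hy, rfl⟩

theorem conePos_le (h : StrongDual ℝ E) {x : E} (hx : 0 ≤ x) {c : ℝ}
    (hc : ∀ y ∈ Set.Icc 0 x, h y ≤ c) : conePos h x ≤ c := by
  refine csSup_le ⟨h 0, 0, ⟨le_rfl, hx⟩, rfl⟩ ?_
  rintro _ ⟨y, hy, rfl⟩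
  exact hc y hy

theorem conePos_nonneg (h : StrongDual ℝ E) {x : E} (hx : 0 ≤ x) : 0 ≤ conePos h x := by
  simpa using le_conePos h (x := x) (y := 0) ⟨le_rfl, hx⟩

theorem conePos_le_norm (h : StrongDual ℝ E) {x : E} (hx : 0 ≤ x) :
    conePos h x ≤ ‖h‖ * ‖x‖ := by
  refine conePos_le h hx fun y hy => ?_
  calc h y ≤ ‖h y‖ := Real.le_norm_self _
    _ ≤ ‖h‖ * ‖y‖ := h.le_opNorm y
    _ ≤ ‖h‖ * ‖x‖ := by gcongr; exact norm_le_of_mem_Icc hy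

theorem conePos_add (h : StrongDual ℝ E) {x y : E} (hx : 0 ≤ x) (hy : 0 ≤ y) :
    conePos h (x + y) = conePos h x + conePos h y := by
  apply le_antisymm
  · refine conePos_le h (add_nonneg hx hy) fun z hz => ?_
    have h1 : h (z ⊓ x) ≤ conePos h x := le_conePos h ⟨le_inf hz.1 hx, inf_le_right⟩
    have h2 : h (z - z ⊓ x) ≤ conePos h y := by
      refine le_conePos h ⟨sub_nonneg.2 inf_le_left, ?_⟩
      rw [sub_le_iff_le_add, add_inf]
      exact le_inf (le_add_of_nonneg_left hy) (by rw [add_comm]; exact hz.2)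
    have h3 : h z = h (z ⊓ x) + h (z - z ⊓ x) := by rw [← map_add]; congr 1; abel
    linarith
  · rw [← le_sub_iff_add_le]
    refine conePos_le h hx fun a ha => ?_
    rw [le_sub_comm]
    refine conePos_le h hy fun b hb => ?_
    have := le_conePos h (x := x + y) (y := a + b)
      ⟨add_nonneg ha.1 hb.1, add_le_add ha.2 hb.2⟩
    rw [map_add] at this
    linarith

theorem conePos_sub_eq (h : StrongDual ℝ E) {a b c d : E} (ha : 0 ≤ a) (hb : 0 ≤ b)
    (hc : 0 ≤ c) (hd : 0 ≤ d) (e : a - b = c - d) :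
    conePos h a - conePos h b = conePos h c - conePos h d := by
  have e' : a + d = c + b := by rw [← sub_eq_zero] at e ⊢; rw [← e]; abel
  have := congrArg (conePos h) e'
  rw [conePos_add h ha hd, conePos_add h hc hb] at this
  linarith

/-- The positive part `h⁺` of a bounded linear functional `h` on a normed lattice
(Riesz–Kantorovich): the linear extension of `x ↦ sup {h y : 0 ≤ y ≤ x}`, `x ≥ 0`. -/
noncomputable def dualPos (h : StrongDual ℝ E) : StrongDual ℝ E :=
  AddMonoidHom.toRealLinearMap
    (AddMonoidHom.mk' (fun x : E => conePos h x⁺ - conePos h x⁻) (by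
      intro x y
      have e := conePos_sub_eq h (posPart_nonneg (x + y)) (negPart_nonneg (x + y))
        (add_nonneg (posPart_nonneg x) (posPart_nonneg y))
        (add_nonneg (negPart_nonneg x) (negPart_nonneg y)) (by
          rw [posPart_sub_negPart, add_sub_add_comm, posPart_sub_negPart,
            posPart_sub_negPart])
      rw [conePos_add h (posPart_nonneg x) (posPart_nonneg y),
        conePos_add h (negPart_nonneg x) (negPart_nonneg y)] at e
      simp only [e]
      ring))
    (by
      refine AddMonoidHomClass.continuous_of_bound _ ‖h‖ fun x => ?_
      have hp : ‖x⁺‖ ≤ ‖x‖ := HasSolidNorm.solid (by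
        rw [abs_of_nonneg (posPart_nonneg x), ← posPart_add_negPart]
        exact le_add_of_nonneg_right (negPart_nonneg x))
      have hn : ‖x⁻‖ ≤ ‖x‖ := HasSolidNorm.solid (by
        rw [abs_of_nonneg (negPart_nonneg x), ← posPart_add_negPart]
        exact le_add_of_nonneg_left (posPart_nonneg x))
      have h1 := conePos_nonneg h (posPart_nonneg x)
      have h2 := conePos_nonneg h (negPart_nonneg x)
      have h3 := (conePos_le_norm h (posPart_nonneg x)).trans
        (mul_le_mul_of_nonneg_left hp (norm_nonneg h))
      have h4 := (conePos_le_norm h (negPart_nonneg x)).trans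
        (mul_le_mul_of_nonneg_left hn (norm_nonneg h))
      simp only [AddMonoidHom.mk'_apply, Real.norm_eq_abs]
      rw [abs_le]
      constructor <;> linarith)

theorem dualPos_apply (h : StrongDual ℝ E) {x : E} (hx : 0 ≤ x) :
    dualPos h x = sSup (h '' Set.Icc 0 x) := by
  change conePos h x⁺ - conePos h x⁻ = conePos h x
  have := conePos_sub_eq h (posPart_nonneg x) (negPart_nonneg x) hx le_rfl
    (by rw [posPart_sub_negPart, sub_zero])
  rw [this]
  have h0 : conePos h (0 : E) = 0 := by simp [conePos]
  rw [h0, sub_zero]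

/-- The order of the dual `E'`: `f ≤ g` iff `f x ≤ g x` for all `x ≥ 0`. -/
instance instPartialOrderDual : PartialOrder (StrongDual ℝ E) where
  le f g := ∀ x : E, 0 ≤ x → f x ≤ g x
  le_refl f x _ := le_rfl
  le_trans f g k h1 h2 x hx := (h1 x hx).trans (h2 x hx)
  le_antisymm f g h1 h2 := by
    ext x
    have hp : f x⁺ = g x⁺ := le_antisymm (h1 _ (posPart_nonneg x)) (h2 _ (posPart_nonneg x))
    have hn : f x⁻ = g x⁻ := le_antisymm (h1 _ (negPart_nonneg x)) (h2 _ (negPart_nonneg x))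
    rw [← posPart_sub_negPart x, map_sub, map_sub, hp, hn]

theorem le_dualPos (h : StrongDual ℝ E) : h ≤ dualPos h := fun x hx => by
  rw [dualPos_apply h hx]
  exact le_conePos h ⟨hx, le_rfl⟩

theorem dualPos_nonneg (h : StrongDual ℝ E) : 0 ≤ dualPos h := fun x hx => by
  rw [dualPos_apply h hx]
  exact conePos_nonneg h hx

theorem dualPos_le {h k : StrongDual ℝ E} (h1 : h ≤ k) (h0 : 0 ≤ k) : dualPos h ≤ k :=
  fun x hx => by
    rw [dualPos_apply h hx]
    refine conePos_le h hx fun y hy => (h1 y hy.1).trans ?_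
    have := h0 (x - y) (sub_nonneg.2 hy.2)
    rw [map_sub] at this
    simpa using this

/-- The dual `E'` is a Riesz space: `f ⊔ g = f + (g - f)⁺` and `f ⊓ g = f - (f - g)⁺`. The fields
below prove that these are the least upper bound and the greatest lower bound. -/
noncomputable instance instLatticeDual : Lattice (StrongDual ℝ E) where
  sup f g := f + dualPos (g - f)
  inf f g := f - dualPos (f - g)
  le_sup_left f g x hx := by
    have := dualPos_nonneg (g - f) x hx
    simpa using this
  le_sup_right f g x hx := by
    have := le_dualPos (g - f) x hx
    simp only [sub_apply, add_apply] at this ⊢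
    linarith
  sup_le f g k h1 h2 x hx := by
    have : dualPos (g - f) ≤ k - f := dualPos_le
      (fun y hy => by have := h2 y hy; simpa using this)
      (fun y hy => by have := h1 y hy; simpa using this)
    have := this x hx
    simp only [sub_apply, add_apply] at this ⊢
    linarith
  inf_le_left f g x hx := by
    have := dualPos_nonneg (f - g) x hx
    simpa using this
  inf_le_right f g x hx := by
    have := le_dualPos (f - g) x hx
    simp only [sub_apply] at this ⊢
    linarith
  le_inf k f g h1 h2 x hx := by
    have : dualPos (f - g) ≤ f - k := dualPos_le
      (fun y hy => by
        have := h2 y hy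
        simp only [sub_apply]
        linarith)
      (fun y hy => by have := h1 y hy; simpa using this)
    have := this x hx
    simp only [sub_apply] at this ⊢
    linarith

end

end BanachLatticeDual

section

/-- A family is disjoint if `|x α| ⊓ |x β| = 0` for all indices `α ≠ β`. -/
def IsDisjointFamily {ι : Type v} {X : Type u} [AddCommGroup X] [Lattice X] (x : ι → X) : Prop :=
  ∀ α β : ι, α ≠ β → |x α| ⊓ |x β| = 0

/-- A norm bounded family. -/
def IsNormBounded {ι : Type v} {E : Type u} [NormedAddCommGroup E] (x : ι → E) : Prop :=
  ∃ M : ℝ, ∀ α : ι, ‖x α‖ ≤ M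

/-- Unbounded norm convergence of a net: `|x α - a| ⊓ u → 0` in norm for every `u ≥ 0`. -/
def UNTendsto {ι : Type v} [Preorder ι] {E : Type u} [NormedAddCommGroup E] [Lattice E]
    (x : ι → E) (a : E) : Prop :=
  ∀ u : E, 0 ≤ u → Tendsto (fun α => |x α - a| ⊓ u) atTop (𝓝 0)

/-- Unbounded absolute weak convergence of a net: `|x α - a| ⊓ u → 0` in the weak topology
`σ(E, E')` for every `u ≥ 0`. -/
def UAWTendsto {ι : Type v} [Preorder ι] {E : Type u} [NormedAddCommGroup E] [NormedSpace ℝ E]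
    [Lattice E] (x : ι → E) (a : E) : Prop :=
  ∀ u : E, 0 ≤ u → Tendsto (fun α => toWeakSpace ℝ E (|x α - a| ⊓ u)) atTop (𝓝 0)

/-- The norm is order continuous: `‖x α‖ → 0` for every net `x α ↓ 0`. (Every decreasing net can be
reindexed by its range, so index sets in the universe of `E` cover all nets.) -/
def HasOrderContinuousNorm (E : Type u) [NormedAddCommGroup E] [Lattice E] : Prop :=
  ∀ (ι : Type u) [Preorder ι] [IsDirectedOrder ι] [Nonempty ι] (x : ι → E),
    Antitone x → IsGLB (Set.range x) 0 → Tendsto (fun α => ‖x α‖) atTop (𝓝 0)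

variable {E : Type u} [NormedAddCommGroup E] [NormedSpace ℝ E] [Lattice E]

/-- `f` is bounded uaw-continuous: `f (x α) → 0` for every norm bounded uaw-null net.
The universe `v` of the index sets is arbitrary. -/
def IsBoundedUAWContinuous (f : StrongDual ℝ E) : Prop :=
  ∀ (ι : Type v) [Preorder ι] [IsDirectedOrder ι] [Nonempty ι] (x : ι → E),
    IsNormBounded x → UAWTendsto x 0 → Tendsto (fun α => f (x α)) atTop (𝓝 0)

/-- `f` is bounded un-continuous: `f (x α) → 0` for every norm bounded un-null net. -/
def IsBoundedUNContinuous (f : StrongDual ℝ E) : Prop :=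
  ∀ (ι : Type v) [Preorder ι] [IsDirectedOrder ι] [Nonempty ι] (x : ι → E),
    IsNormBounded x → UNTendsto x 0 → Tendsto (fun α => f (x α)) atTop (𝓝 0)

/-- `f` is bounded d-continuous: `f (x α) → 0` for every norm bounded disjoint net. The directed
index set has no greatest element; this excludes degenerate nets, such as those with just one term,
which are disjoint for a trivial reason. -/
def IsBoundedDContinuous (f : StrongDual ℝ E) : Prop :=
  ∀ (ι : Type v) [Preorder ι] [IsDirectedOrder ι] [Nonempty ι] [NoTopOrder ι] (x : ι → E),
    IsNormBounded x → IsDisjointFamily x → Tendsto (fun α => f (x α)) atTop (𝓝 0)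

end

/-! The pivot is `IsAlmostOrderBounded`: for `|f|`, each norm ball of positive vectors lies, up to
ε, below a single `w`. Splitting `x = x ⊓ w + (x - w)⁺` then gives uaw-continuity (the first term is
small by uaw-nullity) and condition 5 (disjoint `φ n ≤ |f|` satisfy `φ n w → 0`, and `|f|` controls
the rest). `isAlmostOrderBounded_of_disjoint` derives the pivot from condition 4 by a
disjointification argument: its failure yields a bounded disjoint sequence on which `|f|` does not
tend to zero. Conversely, disjoint vectors carry disjoint components of `|f|`, so 5 gives 4
(`tendsto_apply_of_dual_disjoint`). Disjoint sequences are uaw-null, which gives 2 → 4. Under order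
continuity of the norm they are even un-null, and since un-null implies uaw-null, 6 and 7 join the
cycle. -/

set_option linter.unusedSectionVars false

namespace BanachLatticeDual

/-! ### Disjointness in Riesz spaces. -/

section Riesz

variable {X : Type u} [AddCommGroup X] [Lattice X] [IsOrderedAddMonoid X]

theorem add_inf_le_add {a b c : X} (ha : 0 ≤ a) (hb : 0 ≤ b) (hc : 0 ≤ c) :
    (a + b) ⊓ c ≤ a ⊓ c + b ⊓ c := by
  rw [add_inf, inf_add, inf_add]
  exact le_inf (le_inf inf_le_left (inf_le_right.trans (le_add_of_nonneg_right hb)))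
    (inf_le_right.trans (le_inf (le_add_of_nonneg_left ha) (le_add_of_nonneg_left hc)))

theorem add_inf_eq_zero {a b c : X} (ha : 0 ≤ a) (hb : 0 ≤ b) (hc : 0 ≤ c)
    (hac : a ⊓ c = 0) (hbc : b ⊓ c = 0) : (a + b) ⊓ c = 0 :=
  le_antisymm ((add_inf_le_add ha hb hc).trans (by rw [hac, hbc, add_zero]))
    (le_inf (add_nonneg ha hb) hc)

theorem nsmul_inf_eq_zero {a c : X} (ha : 0 ≤ a) (hc : 0 ≤ c) (hac : a ⊓ c = 0) (k : ℕ) :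
    (k • a) ⊓ c = 0 := by
  induction k with
  | zero => rw [zero_nsmul, inf_eq_left.2 hc]
  | succ k ih => rw [succ_nsmul]; exact add_inf_eq_zero (nsmul_nonneg ha k) ha hc ih hac

theorem inf_eq_zero_of_le {a b c d : X} (ha : 0 ≤ a) (hb : 0 ≤ b) (hac : a ≤ c) (hbd : b ≤ d)
    (h : c ⊓ d = 0) : a ⊓ b = 0 :=
  le_antisymm ((inf_le_inf hac hbd).trans h.le) (le_inf ha hb)

theorem inf_add_posPart_sub (x u : X) : x ⊓ u + (x - u)⁺ = x := by
  have : x ⊓ u = x - (x - u)⁺ := by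
    rw [posPart_def, sub_sup, sub_sub_cancel, sub_zero, inf_comm]
  rw [this, sub_add_cancel]

/-- Since `a + b = a ⊓ b + a ⊔ b`, sums of disjoint positive elements are suprema. The inner
induction shows that a partial sum stays disjoint from each new term. -/
theorem sum_le_of_disjoint {ι : Type*} {z : ι → X} {w : X} (hw : 0 ≤ w)
    (hz : ∀ i, z i ∈ Set.Icc 0 w) (hd : ∀ i j, i ≠ j → z i ⊓ z j = 0) (s : Finset ι) :
    ∑ i ∈ s, z i ≤ w := by
  classical
  induction s using Finset.induction_on with
  | empty => simpa using hw
  | insert a s ha ih =>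
    have key : ∀ t : Finset ι, a ∉ t → (∑ i ∈ t, z i) ⊓ z a = 0 := by
      intro t
      induction t using Finset.induction_on with
      | empty => intro _; rw [Finset.sum_empty, inf_eq_left.2 (hz a).1]
      | insert b t hb iht =>
        intro hat
        rw [Finset.mem_insert, not_or] at hat
        rw [Finset.sum_insert hb]
        exact add_inf_eq_zero (hz b).1 (Finset.sum_nonneg fun i _ => (hz i).1) (hz a).1
          (hd b a (Ne.symm hat.1)) (iht hat.2)
    rw [Finset.sum_insert ha, ← inf_add_sup, inf_comm, key s ha, zero_add]
    exact sup_le (hz a).2 ih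

theorem _root_.IsDisjointFamily.mono {ι : Type v} {x y : ι → X} (hx : IsDisjointFamily x)
    (h : ∀ i, |y i| ≤ |x i|) : IsDisjointFamily y := fun i j hij =>
  inf_eq_zero_of_le (abs_nonneg _) (abs_nonneg _) (h i) (h j) (hx i j hij)

theorem _root_.IsDisjointFamily.inf_eq_zero {ι : Type v} {x : ι → X} (hx : IsDisjointFamily x)
    (h : ∀ i, 0 ≤ x i) {i j : ι} (hij : i ≠ j) : x i ⊓ x j = 0 := by
  have := hx i j hij
  rwa [abs_of_nonneg (h i), abs_of_nonneg (h j)] at this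

end Riesz

/-! ### The modulus, components and weak limits of functionals. -/

section Dual

variable {E : Type u} [NormedAddCommGroup E] [NormedSpace ℝ E] [Lattice E]
  [IsOrderedAddMonoid E] [HasSolidNorm E]

instance instIsOrderedAddMonoidDual : IsOrderedAddMonoid (StrongDual ℝ E) where
  add_le_add_left f g h k x hx := by
    have := h x hx
    simp only [add_apply]
    linarith

theorem dual_mono {g : StrongDual ℝ E} (hg : 0 ≤ g) {x y : E} (h : x ≤ y) : g x ≤ g y := by
  have := hg (y - x) (sub_nonneg.2 h)
  rw [map_sub] at this
  simpa using this

theorem dual_nonneg {g : StrongDual ℝ E} (hg : 0 ≤ g) {x : E} (h : 0 ≤ x) : 0 ≤ g x := by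
  simpa using dual_mono hg h

theorem abs_apply_le (f : StrongDual ℝ E) (x : E) : |f x| ≤ |f| |x| := by
  have h1 := le_abs_self f _ (posPart_nonneg x)
  have h2 := le_abs_self f _ (negPart_nonneg x)
  have h3 := neg_le_abs f _ (posPart_nonneg x)
  have h4 := neg_le_abs f _ (negPart_nonneg x)
  have e : f x = f x⁺ - f x⁻ := by rw [← map_sub, posPart_sub_negPart]
  rw [← posPart_add_negPart x, map_add, e, abs_le]
  simp only [neg_apply] at h3 h4
  constructor <;> linarith

/-- The values of the modulus of a functional are approximated on order intervals `[-x, x]`. -/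
theorem exists_abs_le_lt_apply (f : StrongDual ℝ E) {x : E} (hx : 0 ≤ x) {δ : ℝ} (hδ : 0 < δ) :
    ∃ y : E, |y| ≤ x ∧ |f| x - δ < f y := by
  -- By definition of the dual lattice, `|f| = f ⊔ -f = f + (-2f)⁺`. If `z` nearly attains the
  -- supremum of `-2f` on `[0, x]`, then `y = x - 2z` works.
  have e : |f| x = f x + dualPos (-f - f) x := rfl
  rw [dualPos_apply _ hx] at e
  obtain ⟨_, ⟨z, hz, rfl⟩, h⟩ := exists_lt_of_lt_csSup
    (s := (-f - f : StrongDual ℝ E) '' Set.Icc 0 x) ⟨_, 0, ⟨le_rfl, hx⟩, rfl⟩ (sub_lt_self _ hδ)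
  refine ⟨x - z - z, abs_le'.2 ⟨?_, ?_⟩, ?_⟩
  · exact (sub_le_self _ hz.1).trans (sub_le_self _ hz.1)
  · have : -(x - z - z) = z - (x - z) := by abel
    rw [this]
    exact (sub_le_self _ (sub_nonneg.2 hz.2)).trans hz.2
  · have hz' : (-f - f : StrongDual ℝ E) z = -f z - f z := rfl
    rw [map_sub, map_sub]
    linarith

theorem norm_posPart_le_norm (x : E) : ‖x⁺‖ ≤ ‖x‖ := HasSolidNorm.solid (by
  rw [abs_of_nonneg (posPart_nonneg x), ← posPart_add_negPart]
  exact le_add_of_nonneg_right (negPart_nonneg x))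

theorem norm_negPart_le_norm (x : E) : ‖x⁻‖ ≤ ‖x‖ := HasSolidNorm.solid (by
  rw [abs_of_nonneg (negPart_nonneg x), ← posPart_add_negPart]
  exact le_add_of_nonneg_left (posPart_nonneg x))

/-- An additive function on the positive cone dominated by a bounded functional extends to a
bounded functional. -/
theorem exists_dual_of_cone (g : StrongDual ℝ E) (p : E → ℝ)
    (hadd : ∀ x y, 0 ≤ x → 0 ≤ y → p (x + y) = p x + p y)
    (h0 : ∀ x, 0 ≤ x → 0 ≤ p x) (hg : ∀ x, 0 ≤ x → p x ≤ g x) :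
    ∃ φ : StrongDual ℝ E, ∀ x, 0 ≤ x → φ x = p x := by
  have hsub : ∀ a b c d : E, 0 ≤ a → 0 ≤ b → 0 ≤ c → 0 ≤ d → a - b = c - d →
      p a - p b = p c - p d := by
    intro a b c d ha hb hc hd e
    have := congrArg p (sub_eq_sub_iff_add_eq_add.1 e)
    rw [hadd a d ha hd, hadd c b hc hb] at this
    linarith
  have hz : p 0 = 0 := by simpa using hadd 0 0 le_rfl le_rfl
  have hle : ∀ x, 0 ≤ x → p x ≤ ‖g‖ * ‖x‖ := fun x hx =>
    (hg x hx).trans ((Real.le_norm_self _).trans (g.le_opNorm x))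
  let F : E →+ ℝ := AddMonoidHom.mk' (fun x => p x⁺ - p x⁻) fun x y => by
    have e := hsub _ _ _ _ (posPart_nonneg (x + y)) (negPart_nonneg (x + y))
        (add_nonneg (posPart_nonneg x) (posPart_nonneg y))
        (add_nonneg (negPart_nonneg x) (negPart_nonneg y)) (by
          rw [posPart_sub_negPart, add_sub_add_comm, posPart_sub_negPart, posPart_sub_negPart])
    rw [hadd _ _ (posPart_nonneg x) (posPart_nonneg y),
      hadd _ _ (negPart_nonneg x) (negPart_nonneg y)] at e
    rw [e]
    ring
  refine ⟨F.toRealLinearMap (AddMonoidHomClass.continuous_of_bound F ‖g‖ fun x => ?_),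
    fun x hx => ?_⟩
  · have h1 := h0 _ (posPart_nonneg x)
    have h2 := h0 _ (negPart_nonneg x)
    have h3 := (hle _ (posPart_nonneg x)).trans
      (mul_le_mul_of_nonneg_left (norm_posPart_le_norm x) (norm_nonneg g))
    have h4 := (hle _ (negPart_nonneg x)).trans
      (mul_le_mul_of_nonneg_left (norm_negPart_le_norm x) (norm_nonneg g))
    change |p x⁺ - p x⁻| ≤ _
    rw [abs_le]
    constructor <;> linarith
  · change p x⁺ - p x⁻ = p x
    rw [posPart_of_nonneg hx, negPart_of_nonneg hx, hz, sub_zero]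

/-- The component of `g ≥ 0` carried by the band generated by `z ≥ 0`, with values
`x ↦ sup {g (x ⊓ k z) : k ∈ ℕ}` on the positive cone. -/
theorem exists_component {g : StrongDual ℝ E} (hg : 0 ≤ g) {z : E} (hz : 0 ≤ z) :
    ∃ φ : StrongDual ℝ E, ∀ x, 0 ≤ x → φ x = ⨆ k : ℕ, g (x ⊓ k • z) := by
  have hbdd : ∀ x : E, BddAbove (Set.range fun k : ℕ => g (x ⊓ k • z)) := fun x =>
    ⟨g x, by rintro _ ⟨k, rfl⟩; exact dual_mono hg inf_le_left⟩
  have hmono : ∀ x : E, Monotone fun k : ℕ => g (x ⊓ k • z) := fun x j k hjk =>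
    dual_mono hg (inf_le_inf_left _ (nsmul_le_nsmul_left hz hjk))
  refine exists_dual_of_cone g _ (fun x y hx hy => ?_) (fun x hx => ?_) (fun x hx => ?_)
  · apply le_antisymm
    · refine ciSup_le fun k => ?_
      calc g ((x + y) ⊓ k • z) ≤ g (x ⊓ k • z + y ⊓ k • z) :=
            dual_mono hg (add_inf_le_add hx hy (nsmul_nonneg hz k))
        _ = g (x ⊓ k • z) + g (y ⊓ k • z) := map_add _ _ _
        _ ≤ _ := add_le_add (le_ciSup (hbdd x) k) (le_ciSup (hbdd y) k)
    · rw [← le_sub_iff_add_le]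
      refine ciSup_le fun j => ?_
      rw [le_sub_comm]
      refine ciSup_le fun k => ?_
      rw [le_sub_iff_add_le, ← map_add]
      -- Truncations at `j • z` and `k • z` add up to at most the truncation of `x + y` at `(k + j)
      -- • z`.
      refine le_trans (dual_mono hg ?_) (le_ciSup (hbdd (x + y)) (k + j))
      rw [add_nsmul, add_comm x]
      exact le_inf (add_le_add inf_le_left inf_le_left) (add_le_add inf_le_right inf_le_right)
  · exact le_ciSup_of_le (hbdd x) 0 (dual_nonneg hg (le_inf hx (nsmul_nonneg hz 0)))
  · exact ciSup_le fun k => dual_mono hg inf_le_left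

theorem tendsto_zero_of_sum_le {a : ℕ → ℝ} {c : ℝ} (h0 : ∀ n, 0 ≤ a n)
    (h : ∀ s : Finset ℕ, ∑ i ∈ s, a i ≤ c) : Tendsto a atTop (𝓝 0) :=
  (summable_of_sum_le h0 h).tendsto_atTop_zero

/-- The partial sums of `z` stay below `w`, so the series of the values `g (z n)` is bounded by `g
w` and converges. -/
theorem tendsto_apply_of_disjoint_le {g : StrongDual ℝ E} (hg : 0 ≤ g) {z : ℕ → E} {w : E}
    (hz : ∀ i, z i ∈ Set.Icc 0 w) (hd : ∀ i j, i ≠ j → z i ⊓ z j = 0) :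
    Tendsto (fun n => g (z n)) atTop (𝓝 0) :=
  tendsto_zero_of_sum_le (c := g w) (fun n => dual_nonneg hg (hz n).1) fun s => by
    rw [← map_sum]
    exact dual_mono hg (sum_le_of_disjoint ((hz 0).1.trans (hz 0).2) hz hd s)

theorem tendsto_toWeakSpace_zero_iff {ι : Type*} {l : Filter ι} {y : ι → E} :
    Tendsto (fun i => toWeakSpace ℝ E (y i)) l (𝓝 0) ↔
      ∀ g : StrongDual ℝ E, Tendsto (fun i => g (y i)) l (𝓝 0) := by
  have hind : Topology.IsInducing
      fun (x : WeakSpace ℝ E) (g : StrongDual ℝ E) => (topDualPairing ℝ E).flip x g := ⟨rfl⟩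
  rw [hind.tendsto_nhds_iff, tendsto_pi_nhds]
  refine forall_congr' fun g => ?_
  change Tendsto (fun i => g (y i)) l (𝓝 (g 0)) ↔ _
  rw [map_zero]

end Dual

/-! ### Disjoint and un-null nets are compared with uaw-null nets. -/

section Continuity

variable {E : Type u} [NormedAddCommGroup E] [NormedSpace ℝ E] [Lattice E]
  [IsOrderedAddMonoid E] [HasSolidNorm E]

theorem _root_.IsDisjointFamily.uawTendsto_zero {x : ℕ → E} (hx : IsDisjointFamily x) :
    UAWTendsto x 0 := by
  intro w hw
  rw [tendsto_toWeakSpace_zero_iff]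
  have hz : ∀ n, |x n - 0| ⊓ w ∈ Set.Icc 0 w := fun n =>
    ⟨le_inf (abs_nonneg _) hw, inf_le_right⟩
  have hd : ∀ i j, i ≠ j → (|x i - 0| ⊓ w) ⊓ (|x j - 0| ⊓ w) = 0 := fun i j hij =>
    inf_eq_zero_of_le (hz i).1 (hz j).1 inf_le_left inf_le_left (by
      simpa only [sub_zero] using hx i j hij)
  intro g
  have h1 := tendsto_apply_of_disjoint_le (posPart_nonneg g) hz hd
  have h2 := tendsto_apply_of_disjoint_le (negPart_nonneg g) hz hd
  have h := h1.sub h2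
  rw [sub_zero] at h
  refine h.congr fun n => ?_
  rw [← sub_apply, posPart_sub_negPart]

theorem _root_.UNTendsto.uawTendsto_zero {ι : Type v} [Preorder ι] {x : ι → E} (hx : UNTendsto x 0) :
    UAWTendsto x 0 := fun w hw => by
  rw [tendsto_toWeakSpace_zero_iff]
  intro g
  have := (g.continuous.tendsto 0).comp (hx w hw)
  rwa [map_zero] at this

/-! ### Consequences of almost order boundedness. -/

/-- Norm bounded sets are almost order bounded with respect to the seminorm `x ↦ |f| |x|`. -/
def IsAlmostOrderBounded (f : StrongDual ℝ E) : Prop :=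
  ∀ M ε : ℝ, 0 < ε → ∃ w : E, 0 ≤ w ∧ ∀ x : E, 0 ≤ x → ‖x‖ ≤ M → |f| (x - w)⁺ ≤ ε

theorem IsAlmostOrderBounded.isBoundedUAWContinuous {f : StrongDual ℝ E}
    (hf : IsAlmostOrderBounded f) : IsBoundedUAWContinuous.{u, v} f := by
  intro ι _ _ _ x ⟨M, hM⟩ hx
  rw [Metric.tendsto_nhds]
  intro ε hε
  obtain ⟨w, hw, h⟩ := hf M (ε / 2) (half_pos hε)
  have h1 := tendsto_toWeakSpace_zero_iff.1 (hx w hw) |f|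
  filter_upwards [h1.eventually_lt_const (half_pos hε)] with α hα
  rw [sub_zero] at hα
  have h2 := h |x α| (abs_nonneg _) (by rw [norm_abs_eq_norm]; exact hM α)
  have h3 := abs_apply_le f (x α)
  rw [← inf_add_posPart_sub |x α| w, map_add] at h3
  rw [Real.dist_eq, sub_zero]
  linarith

theorem IsAlmostOrderBounded.tendsto_of_disjoint {f : StrongDual ℝ E}
    (hf : IsAlmostOrderBounded f) {φ : ℕ → StrongDual ℝ E} (hφ : ∀ n, φ n ∈ Set.Icc 0 |f|)
    (hd : IsDisjointFamily φ) : Tendsto φ atTop (𝓝 0) := by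
  rw [Metric.tendsto_nhds]
  intro ε hε
  obtain ⟨w, hw, h⟩ := hf 1 (ε / 8) (by positivity)
  have h1 : Tendsto (fun n => φ n w) atTop (𝓝 0) :=
    tendsto_zero_of_sum_le (c := |f| w) (fun n => (hφ n).1 w hw) fun s => by
      have := sum_le_of_disjoint (abs_nonneg f) hφ
        (fun i j hij => hd.inf_eq_zero (fun n => (hφ n).1) hij) s w hw
      simpa using this
  filter_upwards [h1.eventually_lt_const (show (0 : ℝ) < ε / 8 by positivity)] with n hn
  have hpos : ∀ x : E, 0 ≤ x → ‖x‖ ≤ 1 → φ n x ≤ ε / 4 := fun x hx hx1 => by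
    have e := congrArg (φ n) (inf_add_posPart_sub x w)
    rw [map_add] at e
    have h2 := dual_mono (hφ n).1 (inf_le_right : x ⊓ w ≤ w)
    have h3 := (hφ n).2 _ (posPart_nonneg (x - w))
    have h4 := h x hx hx1
    linarith
  rw [dist_zero_right]
  refine lt_of_le_of_lt (ContinuousLinearMap.opNorm_le_of_unit_norm (C := ε / 2)
    (by positivity) fun x hx => ?_) (half_lt_self hε)
  have e : φ n x = φ n x⁺ - φ n x⁻ := by rw [← map_sub, posPart_sub_negPart]
  have h1 := hpos _ (posPart_nonneg x) ((norm_posPart_le_norm x).trans hx.le)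
  have h2 := hpos _ (negPart_nonneg x) ((norm_negPart_le_norm x).trans hx.le)
  have h3 := dual_nonneg (hφ n).1 (posPart_nonneg x)
  have h4 := dual_nonneg (hφ n).1 (negPart_nonneg x)
  rw [e, Real.norm_eq_abs, abs_le]
  constructor <;> linarith

/-! ### From disjoint functionals back to disjoint vectors. -/

/-- Disjoint elements have disjoint components. -/
theorem component_inf_eq_zero {g : StrongDual ℝ E} (hg : 0 ≤ g) {y z : E} (hy : 0 ≤ y)
    (hz : 0 ≤ z) (hyz : y ⊓ z = 0) {φ ψ : StrongDual ℝ E}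
    (hφ : ∀ x, 0 ≤ x → φ x = ⨆ k : ℕ, g (x ⊓ k • y))
    (hψ : ∀ x, 0 ≤ x → ψ x = ⨆ k : ℕ, g (x ⊓ k • z)) (hφ0 : 0 ≤ φ) (hψ0 : 0 ≤ ψ) :
    φ ⊓ ψ = 0 := by
  refine le_antisymm (fun x hx => ?_) (le_inf hφ0 hψ0)
  have hbdd : ∀ x : E, BddAbove (Set.range fun k : ℕ => g (x ⊓ k • y)) := fun x =>
    ⟨g x, by rintro _ ⟨k, rfl⟩; exact dual_mono hg inf_le_left⟩
  have hψz : ψ y = 0 := by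
    rw [hψ y hy]
    have : ∀ k : ℕ, g (y ⊓ k • z) = 0 := fun k => by
      rw [inf_comm, nsmul_inf_eq_zero hz hy (by rw [inf_comm, hyz]), map_zero]
    simp [this]
  -- `ψ` kills multiples of `y`, so `φ ⊓ ψ` contributes nothing on `x ⊓ k • y` and at most `φ` on
  -- the remainder. Hence `g (x ⊓ k • y) ≤ φ x - (φ ⊓ ψ) x` for every `k`; take the supremum.
  have hle : φ x ≤ φ x - (φ ⊓ ψ) x := by
    nth_rw 1 [hφ x hx]
    refine ciSup_le fun k => ?_
    have hk : 0 ≤ x ⊓ k • y := le_inf hx (nsmul_nonneg hy k)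
    have h1 : g (x ⊓ k • y) ≤ φ (x ⊓ k • y) := by
      rw [hφ _ hk]
      refine le_ciSup_of_le (hbdd _) k ?_
      rw [inf_assoc, inf_idem]
    have h2 : (φ ⊓ ψ) (x - x ⊓ k • y) ≤ φ (x - x ⊓ k • y) :=
      (inf_le_left : φ ⊓ ψ ≤ φ) _ (sub_nonneg.2 inf_le_left)
    have h3 : (φ ⊓ ψ) (x ⊓ k • y) ≤ ψ (x ⊓ k • y) := (inf_le_right : φ ⊓ ψ ≤ ψ) _ hk
    have h4 : ψ (x ⊓ k • y) ≤ 0 := by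
      refine (dual_mono hψ0 inf_le_right).trans ?_
      rw [map_nsmul, hψz, smul_zero]
    rw [map_sub, map_sub] at h2
    linarith
  rw [zero_apply]
  linarith

/-- With `φ n` the component of `|f|` on the band of `|x n|`, nothing is lost at `|x n|` itself: `|f
(x n)| ≤ φ n |x n| ≤ ‖φ n‖ M`. -/
theorem tendsto_apply_of_dual_disjoint {f : StrongDual ℝ E}
    (hf : ∀ φ : ℕ → StrongDual ℝ E, (∀ n, φ n ∈ Set.Icc 0 |f|) → IsDisjointFamily φ →
      Tendsto φ atTop (𝓝 0))
    {x : ℕ → E} (hb : IsNormBounded x) (hx : IsDisjointFamily x) :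
    Tendsto (fun n => f (x n)) atTop (𝓝 0) := by
  obtain ⟨M, hM⟩ := hb
  choose φ hφ using fun n => exists_component (abs_nonneg f) (abs_nonneg (x n))
  have hmem : ∀ n, φ n ∈ Set.Icc 0 |f| := fun n => by
    constructor
    · intro y hy
      rw [hφ n y hy]
      exact Real.iSup_nonneg fun k =>
        dual_nonneg (abs_nonneg f) (le_inf hy (nsmul_nonneg (abs_nonneg _) k))
    · intro y hy
      rw [hφ n y hy]
      exact ciSup_le fun k => dual_mono (abs_nonneg f) inf_le_left
  have hlim := hf φ hmem fun i j hij => by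
    rw [abs_of_nonneg (hmem i).1, abs_of_nonneg (hmem j).1]
    exact component_inf_eq_zero (abs_nonneg f) (abs_nonneg _) (abs_nonneg _) (hx i j hij)
      (hφ i) (hφ j) (hmem i).1 (hmem j).1
  have hlim' := hlim.norm.mul_const M
  rw [norm_zero, zero_mul] at hlim'
  refine squeeze_zero_norm (fun n => ?_) hlim'
  have h1 : |f| |x n| ≤ φ n |x n| := by
    rw [hφ n _ (abs_nonneg _)]
    refine le_ciSup_of_le ⟨|f| |x n|, ?_⟩ 1 ?_
    · rintro _ ⟨k, rfl⟩
      exact dual_mono (abs_nonneg f) inf_le_left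
    · rw [one_nsmul, inf_idem]
  calc ‖f (x n)‖ ≤ |f| |x n| := abs_apply_le f (x n)
    _ ≤ ‖φ n |x n|‖ := h1.trans (Real.le_norm_self _)
    _ ≤ ‖φ n‖ * ‖|x n|‖ := (φ n).le_opNorm _
    _ ≤ ‖φ n‖ * M := by
      rw [norm_abs_eq_norm]
      exact mul_le_mul_of_nonneg_left (hM n) (norm_nonneg _)

/-! ### Disjointification: almost order boundedness from disjoint sequences. -/

/-- Choose `y n` with `|y n| ≤ x n` and `f (y n)` within `1 / (n + 1)` of `|f| (x n)`; solidity
keeps `y` bounded and disjoint. -/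
theorem tendsto_abs_apply_of_disjoint {f : StrongDual ℝ E}
    (hf : ∀ x : ℕ → E, IsNormBounded x → IsDisjointFamily x →
      Tendsto (fun n => f (x n)) atTop (𝓝 0))
    {x : ℕ → E} (h0 : ∀ n, 0 ≤ x n) (hb : IsNormBounded x) (hx : IsDisjointFamily x) :
    Tendsto (fun n => |f| (x n)) atTop (𝓝 0) := by
  choose y hy hfy using fun n : ℕ =>
    exists_abs_le_lt_apply f (h0 n) (Nat.one_div_pos_of_nat (α := ℝ) (n := n))
  have hyx : ∀ n, |y n| ≤ |x n| := fun n => (hy n).trans (le_abs_self _)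
  obtain ⟨M, hM⟩ := hb
  have h := (hf y ⟨M, fun n => (HasSolidNorm.solid (hyx n)).trans (hM n)⟩ (hx.mono hyx)).add
    tendsto_one_div_add_atTop_nhds_zero_nat
  rw [add_zero] at h
  exact squeeze_zero (fun n => dual_nonneg (abs_nonneg f) (h0 n))
    (fun n => by have := hfy n; linarith) h

/-- Both terms are dominated by the disjoint parts `e⁺` and `e⁻` of the one element `e = a - d⁻¹ •
b`. -/
theorem posPart_sub_smul_inf_eq_zero [IsOrderedModule ℝ E] {a b : E} {c d : ℝ} (hb : 0 ≤ b)
    (hd : 0 < d) (hd1 : d ≤ 1) (hcd : 1 ≤ c * d) : (a - c • b)⁺ ⊓ (b - d • a)⁺ = 0 := by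
  set e := a - d⁻¹ • b with he
  have h1 : (a - c • b)⁺ ≤ e⁺ := by
    refine posPart_mono (sub_le_sub_left (smul_le_smul_of_nonneg_right ?_ hb) a)
    rw [inv_le_iff_one_le_mul₀ hd]
    linarith
  have h2 : (b - d • a)⁺ ≤ e⁻ := by
    refine posPart_def (b - d • a) ▸ sup_le ?_ (negPart_nonneg e)
    have e1 : b - d • a = d • (-e) := by
      rw [he, neg_sub, smul_sub, smul_inv_smul₀ hd.ne']
    calc b - d • a = d • (-e) := e1
      _ ≤ d • e⁻ := smul_le_smul_of_nonneg_left (neg_le_negPart e) hd.le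
      _ ≤ (1 : ℝ) • e⁻ := smul_le_smul_of_nonneg_right hd1 (negPart_nonneg e)
      _ = e⁻ := one_smul _ _
  exact inf_eq_zero_of_le (posPart_nonneg _) (posPart_nonneg _) h1 h2
    (posPart_inf_negPart_eq_zero e)

theorem isAlmostOrderBounded_of_disjoint [CompleteSpace E] [IsOrderedModule ℝ E]
    {f : StrongDual ℝ E}
    (hf : ∀ x : ℕ → E, IsNormBounded x → IsDisjointFamily x →
      Tendsto (fun n => f (x n)) atTop (𝓝 0)) : IsAlmostOrderBounded f := by
  by_contra hcon
  unfold IsAlmostOrderBounded at hcon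
  push Not at hcon
  obtain ⟨M, ε, hε, hcon⟩ := hcon
  choose! F hF0 hFM hFε using hcon
  -- `S n` is the sum of the earlier terms, and `x n` is the counterexample to the bound `w = 4 ^ n
  -- • S n`.
  let S : ℕ → E := fun n => Nat.rec 0 (fun n s => s + F ((4 : ℝ) ^ n • s)) n
  let x : ℕ → E := fun n => F ((4 : ℝ) ^ n • S n)
  have hS1 : ∀ n, S (n + 1) = S n + x n := fun n => rfl
  have hS0 : ∀ n, 0 ≤ S n := by
    intro n
    induction n with
    | zero => exact le_rfl
    | succ n ih =>
      rw [hS1]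
      exact add_nonneg ih (hF0 _ (smul_nonneg (by positivity) ih))
  have hw : ∀ n, 0 ≤ (4 : ℝ) ^ n • S n := fun n => smul_nonneg (by positivity) (hS0 n)
  have hx0 : ∀ n, 0 ≤ x n := fun n => hF0 _ (hw n)
  have hxM : ∀ n, ‖x n‖ ≤ M := fun n => hFM _ (hw n)
  have hSmono : Monotone S := monotone_nat_of_le_succ fun n => by
    rw [hS1]; exact le_add_of_nonneg_right (hx0 n)
  have hxS : ∀ {m n}, m < n → x m ≤ S n := fun {m n} hmn =>
    (le_add_of_nonneg_left (hS0 m)).trans ((hS1 m).ge.trans (hSmono hmn))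
  have hsum : Summable fun i : ℕ => (1 / 2 : ℝ) ^ i • x i := by
    refine Summable.of_norm_bounded (summable_geometric_two.mul_right M) fun i => ?_
    rw [norm_smul, Real.norm_of_nonneg (by positivity)]
    exact mul_le_mul_of_nonneg_left (hxM i) (by positivity)
  let y : E := ∑' i, (1 / 2 : ℝ) ^ i • x i
  have hyx : ∀ i, (1 / 2 : ℝ) ^ i • x i ≤ y := fun i =>
    hsum.le_tsum i fun j _ => smul_nonneg (by positivity) (hx0 j)
  have hy0 : 0 ≤ y := (smul_nonneg (by positivity) (hx0 0)).trans (hyx 0)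
  -- Subtracting `4 ^ n • S n` separates `v n` from earlier terms; subtracting the small multiple of
  -- `y`, which dominates every `2⁻ⁱ • x i`, separates it from later ones.
  let v : ℕ → E := fun n => (x n - (4 : ℝ) ^ n • S n - (1 / 2 : ℝ) ^ n • y)⁺
  have hv0 : ∀ n, 0 ≤ v n := fun n => posPart_nonneg _
  have hvx : ∀ n, v n ≤ x n := fun n => by
    refine (posPart_mono ((sub_le_self _ (smul_nonneg (by positivity) hy0)).trans
      (sub_le_self _ (hw n)))).trans_eq (posPart_of_nonneg (hx0 n))
  -- Here `v n ≤ (x n - 4 ^ n • x m)⁺` and `v m ≤ (x m - 2⁻⁽ᵐ⁺ⁿ⁾ • x n)⁺`, and the product of the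
  -- two constants is `2 ^ (n - m) ≥ 1`.
  have hdis : ∀ m n, m < n → v n ⊓ v m = 0 := fun m n hmn => by
    refine inf_eq_zero_of_le (hv0 n) (hv0 m) (posPart_mono ?_) (posPart_mono ?_)
      (posPart_sub_smul_inf_eq_zero (a := x n) (b := x m) (c := 4 ^ n) (d := (1 / 2) ^ (m + n))
        (hx0 m) (by positivity) (pow_le_one₀ (by norm_num) (by norm_num)) ?_)
    · exact (sub_le_self _ (smul_nonneg (by positivity) hy0)).trans
        (sub_le_sub_left (smul_le_smul_of_nonneg_left (hxS hmn) (by positivity)) _)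
    · refine sub_le_sub (sub_le_self _ (hw m)) ?_
      rw [pow_add, mul_smul]
      exact smul_le_smul_of_nonneg_left (hyx n) (by positivity)
    · have : (4 : ℝ) ^ n = 2 ^ (n + n) := by rw [← two_mul, pow_mul]; norm_num
      rw [this, one_div_pow, mul_one_div, one_le_div (by positivity)]
      exact pow_le_pow_right₀ (by norm_num) (by omega)
  have hlim := tendsto_abs_apply_of_disjoint hf hv0
    ⟨M, fun n => (norm_le_of_mem_Icc ⟨hv0 n, hvx n⟩).trans (hxM n)⟩ fun i j hij => by
      rw [abs_of_nonneg (hv0 i), abs_of_nonneg (hv0 j)]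
      rcases hij.lt_or_gt with h | h
      · rw [inf_comm]; exact hdis i j h
      · exact hdis j i h
  have hlim2 : Tendsto (fun n : ℕ => (1 / 2 : ℝ) ^ n * |f| y) atTop (𝓝 0) := by
    simpa using (tendsto_pow_atTop_nhds_zero_of_lt_one (r := (1 / 2 : ℝ)) (by norm_num)
      (by norm_num)).mul_const (|f| y)
  have hlim3 := hlim.add hlim2
  rw [add_zero] at hlim3
  -- `ε < |f| (x n - 4 ^ n • S n)⁺ ≤ |f| (v n) + 2⁻ⁿ |f| y`, whose right side tends to zero.
  refine absurd (ge_of_tendsto' hlim3 fun n => ?_) (not_le.2 hε)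
  refine (hFε _ (hw n)).le.trans ?_
  rw [← smul_eq_mul, ← map_smul, ← map_add]
  refine dual_mono (abs_nonneg f) (posPart_def (x n - (4 : ℝ) ^ n • S n) ▸ sup_le ?_
    (add_nonneg (hv0 n) (smul_nonneg (by positivity) hy0)))
  exact sub_le_iff_le_add.1 (le_posPart _)

/-! ### Passage between sequences and nets. -/

/-- Disjointness ignores the order of the indices, so any injective sequence of bad indices gives a
disjoint sequence contradicting `hf`. -/
theorem isBoundedDContinuous_of_disjoint_sequence {f : StrongDual ℝ E}
    (hf : ∀ x : ℕ → E, IsNormBounded x → IsDisjointFamily x →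
      Tendsto (fun n => f (x n)) atTop (𝓝 0)) : IsBoundedDContinuous.{u, v} f := by
  intro ι _ _ _ _ x ⟨M, hM⟩ hx
  by_contra hcon
  rw [Metric.tendsto_nhds] at hcon
  push Not at hcon
  obtain ⟨ε, hε, hfreq⟩ := hcon
  have hfreq' := frequently_atTop.1 (not_eventually.1 hfreq)
  -- A finite set of bad indices has an upper bound `δ`. As `δ` is not greatest, some `b` is not
  -- below it, yet a bad index occurs above both.
  have hinf : {α : ι | ¬ dist (f (x α)) 0 < ε}.Infinite := by
    intro hfin
    obtain ⟨δ, hδ⟩ := hfin.bddAbove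
    obtain ⟨b, hb⟩ := exists_not_le δ
    obtain ⟨γ, hγ1, hγ2⟩ := exists_ge_ge δ b
    obtain ⟨β, hβ, hβε⟩ := hfreq' γ
    exact hb (hγ2.trans (hβ.trans (hδ (not_lt.2 (not_not.1 hβε)))))
  let e := hinf.natEmbedding
  have h := hf (fun n => x (e n)) ⟨M, fun n => hM _⟩ fun i j hij =>
    hx _ _ fun h => hij (e.injective (Subtype.ext h))
  obtain ⟨n, hn⟩ := ((Metric.tendsto_nhds.1 h) ε hε).exists
  exact (e n).2 hn

/-- `ULift ℕ` makes sequences into nets indexed in an arbitrary universe. -/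
instance instNoTopOrderULiftNat : NoTopOrder (ULift.{v} ℕ) :=
  ⟨fun a => ⟨⟨a.down + 1⟩, fun h => Nat.not_succ_le_self a.down h⟩⟩

theorem tendsto_ulift_down : Tendsto (ULift.down : ULift.{v} ℕ → ℕ) atTop atTop :=
  tendsto_atTop.2 fun n => (eventually_ge_atTop (⟨n⟩ : ULift ℕ)).mono fun _ h => h

theorem tendsto_ulift_up : Tendsto (ULift.up : ℕ → ULift.{v} ℕ) atTop atTop :=
  tendsto_atTop.2 fun n => (eventually_ge_atTop n.down).mono fun _ h => h

/-! ### Order continuous norm. -/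

/-- In a Banach lattice with order continuous norm, order bounded disjoint sequences are
norm null. -/
theorem tendsto_of_disjoint_le_of_orderContinuous [IsOrderedModule ℝ E]
    (hE : HasOrderContinuousNorm E) {z : ℕ → E} {w : E} (hz : ∀ i, z i ∈ Set.Icc 0 w)
    (hd : ∀ i j, i ≠ j → z i ⊓ z j = 0) : Tendsto z atTop (𝓝 0) := by
  let s : ℕ → E := fun n => ∑ i ∈ Finset.range n, z i
  have hs : Monotone s := monotone_nat_of_le_succ fun n => by
    simp only [s, Finset.sum_range_succ]
    exact le_add_of_nonneg_right (hz n).1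
  let U : Set E := upperBounds (Set.range s)
  have hwU : w ∈ U := by
    rintro _ ⟨n, rfl⟩
    exact sum_le_of_disjoint ((hz 0).1.trans (hz 0).2) hz hd _
  -- The supremum of the partial sums need not be known to exist, so order continuity is applied to
  -- all differences "upper bound minus partial sum", which decrease to zero.
  let ι := Uᵒᵈ × ULift.{u} ℕ
  have : IsDirectedOrder ι := ⟨fun a b => by
    refine ⟨(OrderDual.toDual ⟨(OrderDual.ofDual a.1).1 ⊓ (OrderDual.ofDual b.1).1, ?_⟩,
      a.2 ⊔ b.2), ⟨?_, le_sup_left⟩, ⟨?_, le_sup_right⟩⟩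
    · rintro y hy
      exact le_inf ((OrderDual.ofDual a.1).2 hy) ((OrderDual.ofDual b.1).2 hy)
    · exact (inf_le_left : (OrderDual.ofDual a.1).1 ⊓ (OrderDual.ofDual b.1).1 ≤ _)
    · exact (inf_le_right : (OrderDual.ofDual a.1).1 ⊓ (OrderDual.ofDual b.1).1 ≤ _)⟩
  have : Nonempty ι := ⟨(OrderDual.toDual ⟨w, hwU⟩, ⟨0⟩)⟩
  let x : ι → E := fun a => (OrderDual.ofDual a.1).1 - s a.2.down
  have hanti : Antitone x := fun a b hab =>
    sub_le_sub (show (OrderDual.ofDual b.1).1 ≤ (OrderDual.ofDual a.1).1 from hab.1) (hs hab.2)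
  have hglb : IsGLB (Set.range x) 0 := by
    constructor
    · rintro _ ⟨a, rfl⟩
      exact sub_nonneg.2 ((OrderDual.ofDual a.1).2 ⟨_, rfl⟩)
    · intro c hc
      -- A lower bound `c` lets `c⁺` be subtracted from any upper bound. Iterating from `w` gives `k
      -- • c⁺ ≤ w` for all `k`, so `c⁺ = 0` by comparing norms.
      have hcU : ∀ b ∈ U, b - c⁺ ∈ U := by
        rintro b hb _ ⟨n, rfl⟩
        have h1 : c ≤ b - s n := hc ⟨(OrderDual.toDual ⟨b, hb⟩, ⟨n⟩), rfl⟩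
        have h2 : c⁺ ≤ b - s n := posPart_def c ▸ sup_le h1 (sub_nonneg.2 (hb ⟨n, rfl⟩))
        exact le_sub_comm.1 h2
      have hk : ∀ k : ℕ, w - k • c⁺ ∈ U := by
        intro k
        induction k with
        | zero => simpa using hwU
        | succ k ih => rw [succ_nsmul, ← sub_sub]; exact hcU _ ih
      have hkc : ∀ k : ℕ, k • c⁺ ≤ w := fun k => by
        have : s 0 ≤ w - k • c⁺ := hk k ⟨0, rfl⟩
        simpa [s] using this
      have hnorm : ∀ k : ℕ, (k : ℝ) * ‖c⁺‖ ≤ ‖w‖ := fun k => by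
        have := norm_le_of_mem_Icc ⟨nsmul_nonneg (posPart_nonneg c) k, hkc k⟩
        rwa [← Nat.cast_smul_eq_nsmul ℝ, norm_smul, Real.norm_natCast] at this
      have : c⁺ = 0 := by
        by_contra hne
        obtain ⟨k, hk⟩ := exists_nat_gt (‖w‖ / ‖c⁺‖)
        rw [div_lt_iff₀ (norm_pos_iff.2 hne)] at hk
        exact absurd (hnorm k) (not_le.2 hk)
      exact (le_posPart c).trans this.le
  rw [tendsto_zero_iff_norm_tendsto_zero, Metric.tendsto_atTop]
  intro ε hε
  obtain ⟨a, ha⟩ := ((hE ι x hanti hglb).eventually_lt_const hε).exists_forall_of_atTop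
  refine ⟨a.2.down, fun n hn => ?_⟩
  -- Keep the upper bound `u` of index `a` and advance only `n`: `z n = s (n + 1) - s n ≤ u - s n`.
  have h1 := ha (a.1, ⟨n⟩) ⟨le_rfl, hn⟩
  rw [Real.dist_eq, sub_zero, abs_norm]
  refine (norm_le_of_mem_Icc ⟨(hz n).1, ?_⟩).trans_lt h1
  have h2 : s (n + 1) ≤ (OrderDual.ofDual a.1).1 := (OrderDual.ofDual a.1).2 ⟨_, rfl⟩
  rw [show s (n + 1) = s n + z n from Finset.sum_range_succ _ _] at h2
  exact le_sub_iff_add_le'.2 h2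

theorem _root_.IsDisjointFamily.unTendsto_zero [IsOrderedModule ℝ E] (hE : HasOrderContinuousNorm E)
    {x : ℕ → E} (hx : IsDisjointFamily x) : UNTendsto x 0 := fun w hw => by
  simp only [sub_zero]
  have h0 : ∀ n, 0 ≤ |x n| ⊓ w := fun n => le_inf (abs_nonneg _) hw
  exact tendsto_of_disjoint_le_of_orderContinuous hE (w := w) (fun n => ⟨h0 n, inf_le_right⟩)
    fun i j hij => inf_eq_zero_of_le (h0 i) (h0 j) inf_le_left inf_le_left (hx i j hij)

end Continuity

end BanachLatticeDual

open BanachLatticeDual in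
theorem mainTheorem6 {E : Type u} [NormedAddCommGroup E] [NormedSpace ℝ E]
    [CompleteSpace E] [Lattice E] [IsOrderedAddMonoid E] [IsOrderedModule ℝ E] [HasSolidNorm E]
    (f : StrongDual ℝ E) :
    List.TFAE [
      IsBoundedUAWContinuous.{u, v} f,
      ∀ x : ℕ → E, IsNormBounded x → UAWTendsto x 0 → Tendsto (fun n => f (x n)) atTop (𝓝 0),
      IsBoundedDContinuous.{u, v} f,
      ∀ x : ℕ → E, IsNormBounded x → IsDisjointFamily x →
        Tendsto (fun n => f (x n)) atTop (𝓝 0),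
      ∀ φ : ℕ → StrongDual ℝ E, (∀ n, φ n ∈ Set.Icc 0 |f|) → IsDisjointFamily φ →
        Tendsto φ atTop (𝓝 0)] ∧
    (HasOrderContinuousNorm E →
      List.TFAE [
        IsBoundedUAWContinuous.{u, v} f,
        ∀ x : ℕ → E, IsNormBounded x → UAWTendsto x 0 → Tendsto (fun n => f (x n)) atTop (𝓝 0),
        IsBoundedDContinuous.{u, v} f,
        ∀ x : ℕ → E, IsNormBounded x → IsDisjointFamily x →
          Tendsto (fun n => f (x n)) atTop (𝓝 0),
        ∀ φ : ℕ → StrongDual ℝ E, (∀ n, φ n ∈ Set.Icc 0 |f|) → IsDisjointFamily φ →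
          Tendsto φ atTop (𝓝 0),
        IsBoundedUNContinuous.{u, v} f,
        ∀ x : ℕ → E, IsNormBounded x → UNTendsto x 0 →
          Tendsto (fun n => f (x n)) atTop (𝓝 0)]) := by
  have h12 : IsBoundedUAWContinuous.{u, v} f → ∀ x : ℕ → E, IsNormBounded x →
      UAWTendsto x 0 → Tendsto (fun n => f (x n)) atTop (𝓝 0) := fun h x ⟨M, hM⟩ hx =>
    (h (ULift.{v} ℕ) (fun n => x n.down) ⟨M, fun n => hM _⟩
      fun w hw => (hx w hw).comp tendsto_ulift_down).comp tendsto_ulift_up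
  have h34 : IsBoundedDContinuous.{u, v} f → ∀ x : ℕ → E, IsNormBounded x →
      IsDisjointFamily x → Tendsto (fun n => f (x n)) atTop (𝓝 0) := fun h x ⟨M, hM⟩ hx =>
    (h (ULift.{v} ℕ) (fun n => x n.down) ⟨M, fun n => hM _⟩
      fun i j hij => hx _ _ fun e => hij (ULift.down_injective e)).comp tendsto_ulift_up
  have h67 : IsBoundedUNContinuous.{u, v} f → ∀ x : ℕ → E, IsNormBounded x →
      UNTendsto x 0 → Tendsto (fun n => f (x n)) atTop (𝓝 0) := fun h x ⟨M, hM⟩ hx =>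
    (h (ULift.{v} ℕ) (fun n => x n.down) ⟨M, fun n => hM _⟩
      fun w hw => (hx w hw).comp tendsto_ulift_down).comp tendsto_ulift_up
  have main : List.TFAE [
      IsBoundedUAWContinuous.{u, v} f,
      ∀ x : ℕ → E, IsNormBounded x → UAWTendsto x 0 → Tendsto (fun n => f (x n)) atTop (𝓝 0),
      IsBoundedDContinuous.{u, v} f,
      ∀ x : ℕ → E, IsNormBounded x → IsDisjointFamily x →
        Tendsto (fun n => f (x n)) atTop (𝓝 0),
      ∀ φ : ℕ → StrongDual ℝ E, (∀ n, φ n ∈ Set.Icc 0 |f|) → IsDisjointFamily φ →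
        Tendsto φ atTop (𝓝 0)] := by
    tfae_have 1 → 2 := h12
    tfae_have 2 → 4 := fun h x hb hx => h x hb hx.uawTendsto_zero
    tfae_have 3 → 4 := h34
    tfae_have 4 → 3 := isBoundedDContinuous_of_disjoint_sequence
    tfae_have 4 → 1 := fun h => (isAlmostOrderBounded_of_disjoint h).isBoundedUAWContinuous
    tfae_have 4 → 5 := fun h _ => (isAlmostOrderBounded_of_disjoint h).tendsto_of_disjoint
    tfae_have 5 → 4 := fun h _ => tendsto_apply_of_dual_disjoint h
    tfae_finish
  refine ⟨main, fun hE => ?_⟩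
  tfae_have 1 ↔ 2 := main.out 0 1
  tfae_have 1 ↔ 3 := main.out 0 2
  tfae_have 1 ↔ 4 := main.out 0 3
  tfae_have 1 ↔ 5 := main.out 0 4
  tfae_have 1 → 6 := fun h ι _ _ _ x hb hx => h ι x hb hx.uawTendsto_zero
  tfae_have 6 → 7 := h67
  -- Order continuity of the norm enters only here.
  tfae_have 7 → 4 := fun h x hb hx => h x hb (hx.unTendsto_zero hE)
  tfae_finish
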